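/- Let $M$ be a smooth, compact, connected Riemannian manifold without boundary, of dimension $d\ge 1$, with Riemannian volume measure $dV$, geodesic distance $r$ and Laplace–Beltrami operator $\Delta$. Let $(\varphi_k)_{k\in\mathbb N}$ be an orthonormal basis of the complex Hilbert space $L^2(M)=L^2(M,dV)$ consisting of smooth eigenfunctions, $-\Delta\varphi_k=\lambda_k\varphi_k$, and let $\Lambda$ be the set of distinct eigenvalues of $-\Delta$. For a function $\eta:\Lambda\to\mathbb R$ let $T_\eta$ be the spectral integral operator with kernel $K_\eta(x,y)=\sum_{k}\eta(\lambda_k)\varphi_k(x)\overline{\varphi_k(y)}$, that is, $$T_\eta f=\lim_{N\to\infty}\int_M\sum_{k<N}\eta(\lambda_k)\varphi_k(\cdot)\overline{\varphi_k(y)}f(y)\,dV(y)=\sum_k\eta(\lambda_k)\langle f,\varphi_k\rangle\varphi_k\quad\text{in }L^2(M),$$ with domain $\mathrm{Dom}(T_\eta)$ the set of $f\in L^2(M)$ for which this limit exists. For a diffeomorphism $\zeta$ of $M$ let $V_\zeta f(x)=f(\zeta^{-1}(x))$, and let $\mathrm{Isom}(M)$ be the group of the smooth diffeomorphisms $\zeta$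 of $M$ with $r(\zeta(x),\zeta(y))=r(x,y)$ for all $x,y\in M$. Then, for every $\eta:\Lambda\to\mathbb R$, every $f\in L^2(M)$ and every $\zeta\in\mathrm{Isom}(M)$: $V_\zeta f\in L^2(M)$; $V_\zeta f\in\mathrm{Dom}(T_\eta)$ if and only if $f\in\mathrm{Dom}(T_\eta)$; and, for $f\in \mathrm{Dom}(T_\eta)$, $$T_\eta V_\zeta f=V_\zeta T_\eta f .$$ If $\eta$ is bounded, then $\mathrm{Dom}(T_\eta)=L^2(M)$, so that the identity holds for every $f\in L^2(M)$. -/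

import Mathlib

open scoped Manifold ContDiff Bundle Topology ENNReal InnerProductSpace ComplexConjugate
open MeasureTheory Filter Bundle Manifold

noncomputable section

namespace SpectralGeometry

section Basic

variable (d : ℕ) (M : Type*) [TopologicalSpace M] [ChartedSpace (EuclideanSpace ℝ (Fin d)) M]

/-- The coordinate vector field `∂ᵢ` of the chart `e`, at the point with coordinates `y`. -/
def coordVector {d : ℕ} {M : Type*} [TopologicalSpace M]
    [ChartedSpace (EuclideanSpace ℝ (Fin d)) M]
    (e : OpenPartialHomeomorph M (EuclideanSpace ℝ (Fin d))) (y : EuclideanSpace ℝ (Fin d))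
    (i : Fin d) : TangentSpace (𝓡 d) (e.symm y) :=
  mfderiv (𝓡 d) (𝓡 d) e.symm y (EuclideanSpace.single i (1 : ℝ) : EuclideanSpace ℝ (Fin d))

variable [RiemannianBundle (fun x : M ↦ TangentSpace (𝓡 d) x)]

/-- The matrix `(g_{ij})` of the Riemannian metric in the chart `e`, as a function of the
coordinates `y`. -/
def gramMatrix {d : ℕ} {M : Type*} [TopologicalSpace M]
    [ChartedSpace (EuclideanSpace ℝ (Fin d)) M]
    [RiemannianBundle (fun x : M ↦ TangentSpace (𝓡 d) x)]
    (e : OpenPartialHomeomorph M (EuclideanSpace ℝ (Fin d))) (y : EuclideanSpace ℝ (Fin d)) :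
    Matrix (Fin d) (Fin d) ℝ :=
  Matrix.of fun i j ↦ ⟪coordVector e y i, coordVector e y j⟫_ℝ

/-- The measure `√(det g_{ij}) dy₁ ⋯ dy_d` of the chart `e`, transported to `M`: it lives on the
domain of `e`. -/
def chartVolume {d : ℕ} {M : Type*} [TopologicalSpace M]
    [ChartedSpace (EuclideanSpace ℝ (Fin d)) M]
    [RiemannianBundle (fun x : M ↦ TangentSpace (𝓡 d) x)] [MeasurableSpace M]
    (e : OpenPartialHomeomorph M (EuclideanSpace ℝ (Fin d))) : Measure M :=
  Measure.map e.symm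
    (((volume : Measure (EuclideanSpace ℝ (Fin d))).restrict e.target).withDensity
      fun y ↦ ENNReal.ofReal (√(gramMatrix e y).det))

/-- The Riemannian volume measure `dV`: the least measure on `M` dominating
`√(det g_{ij}) dy₁ ⋯ dy_d` for every smooth chart. By the change of variables formula the chart
measures agree on overlaps, so this is the measure that is given by
`√(det g_{ij}) dy₁ ⋯ dy_d` on each chart domain. -/
def riemannianVolume [MeasurableSpace M] : Measure M :=
  ⨆ e ∈ IsManifold.maximalAtlas (𝓡 d) ∞ M, chartVolume e

variable {M}

instance (x : M) : FiniteDimensional ℝ (TangentSpace (𝓡 d) x) :=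
  inferInstanceAs (FiniteDimensional ℝ (EuclideanSpace ℝ (Fin d)))

/-- The differential at `x` of a complex valued function `u` on `M`, evaluated at a tangent
vector. -/
def differential (u : M → ℂ) (x : M) (v : TangentSpace (𝓡 d) x) : ℂ :=
  mfderiv (𝓡 d) 𝓘(ℝ, ℂ) u x v

/-- The Hermitian inner product `⟨∇u, ∇w⟩` at `x` of the gradients of two complex valued
functions, computed in an orthonormal basis of the tangent space (its value does not depend on the
basis). -/
def gradInner (u w : M → ℂ) (x : M) : ℂ :=
  let b := stdOrthonormalBasis ℝ (TangentSpace (𝓡 d) x)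
  ∑ i, differential d u x (b i) * conj (differential d w x (b i))

/-- `w = Δ u`, where `Δ = div ∘ ∇ = -d* d` is the Laplace-Beltrami operator on smooth functions of a
closed Riemannian manifold, and `-div` is the formal adjoint of the gradient: `Δ u` is the unique smooth
function such that `∫ (Δ u) ψ̄ dV = -∫ ⟨∇u, ∇ψ⟩ dV` for every smooth function `ψ`. -/
structure IsLaplaceBeltrami [MeasurableSpace M] (u w : M → ℂ) : Prop where
  smooth : ContMDiff (𝓡 d) 𝓘(ℝ, ℂ) ∞ u
  smooth_laplacian : ContMDiff (𝓡 d) 𝓘(ℝ, ℂ) ∞ w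
  integral_eq : ∀ ψ : M → ℂ, ContMDiff (𝓡 d) 𝓘(ℝ, ℂ) ∞ ψ →
    ∫ x, w x * conj (ψ x) ∂(riemannianVolume d M)
      = -∫ x, gradInner d u ψ x ∂(riemannianVolume d M)

/-- `φ` is an eigenfunction of `-Δ` with eigenvalue `lam`. -/
def IsEigenfunction [MeasurableSpace M] (lam : ℝ) (φ : M → ℂ) : Prop :=
  φ ≠ 0 ∧ IsLaplaceBeltrami d φ (fun x ↦ -((lam : ℂ) * φ x))

variable (M) in
/-- The set `Λ` of the distinct eigenvalues of `-Δ`. -/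
def eigenvalueSet [MeasurableSpace M] : Set ℝ :=
  {lam | ∃ φ : M → ℂ, IsEigenfunction d lam φ}

variable (M) in
/-- An orthonormal basis `(φ_k)` of the complex Hilbert space `L²(M)` consisting of eigenfunctions
of `-Δ`, with eigenvalues `lam k`. -/
structure LaplaceEigenbasis [MeasurableSpace M] where
  /-- the eigenfunctions -/
  φ : ℕ → M → ℂ
  /-- the eigenvalues, repeated according to multiplicity -/
  lam : ℕ → ℝ
  isEigenfunction : ∀ k, IsEigenfunction d (lam k) (φ k)
  /-- the classes of the eigenfunctions in `L²(M)` -/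
  basis : HilbertBasis ℕ ℂ (Lp ℂ 2 (riemannianVolume d M))
  basis_ae_eq : ∀ k, basis k =ᵐ[riemannianVolume d M] φ k

namespace LaplaceEigenbasis

variable {d} [MeasurableSpace M] (B : LaplaceEigenbasis d M)

/-- The eigenvalue of `φ_k`, as an element of `Λ`. -/
def eigenvalue (k : ℕ) : eigenvalueSet d M := ⟨B.lam k, B.φ k, B.isEigenfunction k⟩

/-- The partial sums `∑_{k < N} η(λ_k) φ_k(x) φ̄_k(y)` of the spectral kernel `K_η`. -/
def kernel (η : eigenvalueSet d M → ℝ) (N : ℕ) (x y : M) : ℂ :=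
  ∑ k ∈ Finset.range N, (η (B.eigenvalue k) : ℂ) * B.φ k x * conj (B.φ k y)

/-- `f` lies in the domain of the spectral integral operator `T_η` and `T_η f = g` in `L²(M)`:
the kernel series defining `K_η` is summed in `L²` after application to `f`, that is,
`∫ ∑_{k < N} η(λ_k) φ_k(x) φ̄_k(y) f(y) dV(y)` tends to `g(x)` in `L²(M)` as `N → ∞`. -/
def IsImage (η : eigenvalueSet d M → ℝ) (f g : M → ℂ) : Prop :=
  MemLp g 2 (riemannianVolume d M) ∧
    Tendsto (fun N : ℕ ↦ eLpNorm
        (fun x ↦ (∫ y, B.kernel η N x y * f y ∂(riemannianVolume d M)) - g x)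
        2 (riemannianVolume d M))
      atTop (𝓝 0)

/-- `f` lies in the domain of `T_η`. -/
def InDomain (η : eigenvalueSet d M → ℝ) (f : M → ℂ) : Prop := ∃ g, B.IsImage η f g

open Classical in
/-- The spectral integral operator `T_η`: a representative of the class `T_η f ∈ L²(M)` if `f` lies
in its domain, and `0` otherwise. -/
def spectralOperator (η : eigenvalueSet d M → ℝ) (f : M → ℂ) : M → ℂ :=
  if h : B.InDomain η f then h.choose else 0

end LaplaceEigenbasis

/-- The diffeomorphism `ζ` is an isometry: it preserves the geodesic distance, that is, the infimum
of the lengths of the `C¹` paths between two points. -/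
def IsIsometry (ζ : M ≃ₘ⟮𝓡 d, 𝓡 d⟯ M) : Prop :=
  ∀ x y : M, riemannianEDist (𝓡 d) (ζ x) (ζ y) = riemannianEDist (𝓡 d) x y

end Basic

/-- The operator `V_ζ f(x) = f(ζ⁻¹(x))`. -/
def pushforward {d : ℕ} {M : Type*} [TopologicalSpace M]
    [ChartedSpace (EuclideanSpace ℝ (Fin d)) M]
    (ζ : M ≃ₘ⟮𝓡 d, 𝓡 d⟯ M) (f : M → ℂ) : M → ℂ :=
  fun x ↦ f (ζ.symm x)

end SpectralGeometry

end

noncomputable section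

namespace SpectralGeometry

/-! The operator $V_\zeta$ is unitary on $L^2(M)$ and carries each eigenspace of $-\Delta$ to
itself, while $T_\eta$ acts on each eigenspace as a scalar; so the two commute. Since $\eta$ may be
unbounded, this is argued on Fourier coefficients: by `isImage_iff`, $T_\eta f=g$ means exactly that
$g\in L^2$ and $\hat g(k)=\eta(\lambda_k)\hat f(k)$ for every $k$. The matrix entry
$\langle\varphi_k\circ\zeta,\varphi_j\rangle$ vanishes unless $\lambda_j=\lambda_k$, so $V_\zeta$
respects these relations (`IsImage.pushforward`).

The geometric input is that $\zeta$, assumed only to preserve distance, has an isometric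
differential (`IsIsometry.norm_mfderiv`). This is an infinitesimal comparison: a curve with velocity
$v$ leaves $p$ at metric speed at most $\|v\|$, and a function with gradient of norm at most $C$ is
$C$-Lipschitz for the distance. From $d\zeta$ being isometric it follows that $\zeta$ preserves the
volume, the inner product of gradients and hence the weak equation defining $\Delta$
(`IsLaplaceBeltrami.comp_isometry`). Orthogonality of different eigenspaces is the symmetry of that
weak equation. -/

theorem enorm_le_coe_mul_enorm {E F : Type*} [SeminormedAddCommGroup E] [SeminormedAddCommGroup F]
    {x : E} {y : F} {r : NNReal} (h : ‖x‖ ≤ r * ‖y‖) : ‖x‖ₑ ≤ r * ‖y‖ₑ := by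
  rw [← ofReal_norm, ← ofReal_norm, ← ENNReal.ofReal_coe_nnreal,
    ← ENNReal.ofReal_mul (NNReal.coe_nonneg r)]
  exact ENNReal.ofReal_le_ofReal h

/-! ### Curves that are affine in a chart -/

section Curve

variable {d : ℕ} {M : Type*} [TopologicalSpace M] [ChartedSpace (EuclideanSpace ℝ (Fin d)) M]

/-- The differential at `x` of a real valued function on `M`. -/
def realDifferential (u : M → ℝ) (x : M) (v : TangentSpace (𝓡 d) x) : ℝ :=
  mfderiv (𝓡 d) 𝓘(ℝ, ℝ) u x v

/-- The line through the image of `p` with velocity `v`, in the preferred chart at `p`. -/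
def chartLine (p : M) (v : EuclideanSpace ℝ (Fin d)) (t : ℝ) : EuclideanSpace ℝ (Fin d) :=
  extChartAt (𝓡 d) p p + t • v

/-- The curve with initial point `p` which is affine with velocity `v` in the preferred chart at
`p`. -/
def chartCurve (p : M) (v : EuclideanSpace ℝ (Fin d)) (t : ℝ) : M :=
  (extChartAt (𝓡 d) p).symm (chartLine p v t)

theorem chartLine_zero (p : M) (v : EuclideanSpace ℝ (Fin d)) :
    chartLine p v 0 = extChartAt (𝓡 d) p p := by
  rw [chartLine, zero_smul, add_zero]

theorem chartCurve_zero (p : M) (v : EuclideanSpace ℝ (Fin d)) : chartCurve p v 0 = p := by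
  rw [chartCurve, chartLine_zero, extChartAt_to_inv]

theorem contDiff_chartLine (p : M) (v : EuclideanSpace ℝ (Fin d)) :
    ContDiff ℝ 1 (chartLine p v) :=
  contDiff_const.add (contDiff_id.smul contDiff_const)

theorem hasMFDerivAt_chartLine (p : M) (v : EuclideanSpace ℝ (Fin d)) (t : ℝ) :
    HasMFDerivAt 𝓘(ℝ, ℝ) (𝓡 d) (chartLine p v) t (ContinuousLinearMap.toSpanSingleton ℝ v) := by
  apply HasFDerivAt.hasMFDerivAt
  have := (((hasDerivAt_id t).smul_const v).const_add (extChartAt (𝓡 d) p p)).hasFDerivAt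
  rwa [one_smul] at this

variable [IsManifold (𝓡 d) ∞ M]

theorem hasMFDerivAt_chartCurve (p : M) (v : EuclideanSpace ℝ (Fin d)) {t : ℝ}
    (ht : chartLine p v t ∈ (extChartAt (𝓡 d) p).target) :
    HasMFDerivAt 𝓘(ℝ, ℝ) (𝓡 d) (chartCurve p v) t
      ((mfderiv (𝓡 d) (𝓡 d) (extChartAt (𝓡 d) p).symm (chartLine p v t)).comp
        (ContinuousLinearMap.toSpanSingleton ℝ v)) := by
  have h := mdifferentiableWithinAt_extChartAt_symm ht
  rw [show Set.range (𝓡 d) = Set.univ from (𝓡 d).range_eq_univ, mdifferentiableWithinAt_univ] at h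
  exact h.hasMFDerivAt.comp t (hasMFDerivAt_chartLine _ _ t)

/-- The tangent space at `p` is identified with the model space through the preferred chart at `p`,
so the inverse chart has the identity as its differential at the base point. -/
theorem hasMFDerivAt_chartCurve_zero (p : M) (v : EuclideanSpace ℝ (Fin d)) :
    HasMFDerivAt 𝓘(ℝ, ℝ) (𝓡 d) (chartCurve p v) 0 (ContinuousLinearMap.toSpanSingleton ℝ v) := by
  have h := hasMFDerivAt_chartCurve p v (t := 0)
    (by rw [chartLine_zero]; exact mem_extChartAt_target p)
  rw [chartLine_zero, ← mfderivWithin_univ,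
    ← show Set.range (𝓡 d) = Set.univ from (𝓡 d).range_eq_univ,
    mfderivWithin_range_extChartAt_symm] at h
  exact h

theorem hasMFDerivAt_comp_extChartAt {q y : M}
    (hy : y ∈ (chartAt (EuclideanSpace ℝ (Fin d)) q).source)
    (L : EuclideanSpace ℝ (Fin d) →L[ℝ] ℝ) :
    HasMFDerivAt (𝓡 d) 𝓘(ℝ, ℝ) (fun y ↦ L (extChartAt (𝓡 d) q y)) y
      (L.comp (mfderiv (𝓡 d) (𝓡 d) (extChartAt (𝓡 d) q) y)) :=
  L.hasMFDerivAt.comp y (mdifferentiableAt_extChartAt hy).hasMFDerivAt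

end Curve

/-! ### Distance-preserving diffeomorphisms have isometric differentials -/

section Differential

variable {d : ℕ} {M : Type*} [TopologicalSpace M] [ChartedSpace (EuclideanSpace ℝ (Fin d)) M]
  [IsManifold (𝓡 d) ∞ M] [RiemannianBundle (fun x : M ↦ TangentSpace (𝓡 d) x)]

theorem isContinuousRiemannianBundle_tangentSpace
    [h : IsContMDiffRiemannianBundle (𝓡 d) ∞ (EuclideanSpace ℝ (Fin d))
      (fun x : M ↦ TangentSpace (𝓡 d) x)] :
    IsContinuousRiemannianBundle (EuclideanSpace ℝ (Fin d))
      (fun x : M ↦ TangentSpace (𝓡 d) x) := by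
  obtain ⟨g, hg, hg'⟩ := h.exists_contMDiff
  exact ⟨g, hg.continuous, hg'⟩

/-- A `C¹` function whose differential is bounded by `C` near `p` is `C`-Lipschitz at `p` for the
Riemannian distance. -/
theorem eventually_enorm_sub_le_riemannianEDist [RegularSpace M]
    [IsContinuousRiemannianBundle (EuclideanSpace ℝ (Fin d)) (fun x : M ↦ TangentSpace (𝓡 d) x)]
    {p : M} {s : Set M} (hs : s ∈ 𝓝 p) {u : M → ℝ}
    (hu : ∀ y ∈ s, ContMDiffAt (𝓡 d) 𝓘(ℝ, ℝ) 1 u y) {C : NNReal}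
    (hC : ∀ y ∈ s, ∀ v : TangentSpace (𝓡 d) y, ‖realDifferential u y v‖ₑ ≤ C * ‖v‖ₑ) :
    ∀ᶠ y in 𝓝 p, ‖u y - u p‖ₑ ≤ C * riemannianEDist (𝓡 d) p y := by
  obtain ⟨c, c_pos, hc⟩ := setOfPred_riemannianEDist_lt_subset_nhds' (𝓡 d) hs
  filter_upwards [eventually_riemannianEDist_lt (𝓡 d) p c_pos] with y hy
  -- Any `R` between the distance and `c` bounds the length of some path from `p` to `y`. Such a
  -- path is too short to leave `s`, so the bound on the differential can be integrated along it. At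
  -- the end `R` decreases to the distance.
  have key : ∀ R : ℝ≥0∞, riemannianEDist (𝓡 d) p y < R → R < c → ‖u y - u p‖ₑ ≤ C * R := by
    intro R hR hRc
    obtain ⟨γ, γ0, γ1, γ_smooth, hγ, -⟩ :=
      exists_lt_locally_constant_of_riemannianEDist_lt hR zero_lt_one
    have hmem : ∀ t ∈ Set.Icc (0 : ℝ) 1, γ t ∈ s := by
      intro t ht
      apply hc
      calc riemannianEDist (𝓡 d) p (γ t) ≤ pathELength (𝓡 d) γ 0 t :=
            riemannianEDist_le_pathELength γ_smooth.contMDiffOn γ0 rfl ht.1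
        _ ≤ pathELength (𝓡 d) γ 0 1 := pathELength_mono le_rfl ht.2
        _ < c := hγ.trans hRc
    have hu' : ContMDiffOn 𝓘(ℝ, ℝ) 𝓘(ℝ, ℝ) 1 (u ∘ γ) (Set.Icc 0 1) := fun t ht ↦
      (hu _ (hmem t ht)).comp_contMDiffWithinAt t (γ_smooth.contMDiffAt.contMDiffWithinAt)
    have e0 : u y - u p = (u ∘ γ) 1 - (u ∘ γ) 0 := by simp [γ0, γ1]
    rw [e0]
    calc ‖(u ∘ γ) 1 - (u ∘ γ) 0‖ₑ
        ≤ ∫⁻ t in Set.Icc (0 : ℝ) 1, ‖derivWithin (u ∘ γ) (Set.Icc 0 1) t‖ₑ :=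
          enorm_sub_le_lintegral_derivWithin_Icc_of_contDiffOn_Icc
            (contMDiffOn_iff_contDiffOn.1 hu') zero_le_one
      _ ≤ ∫⁻ t in Set.Icc (0 : ℝ) 1,
            C * ‖mfderivWithin 𝓘(ℝ, ℝ) (𝓡 d) γ (Set.Icc 0 1) t 1‖ₑ := by
          refine setLIntegral_mono' measurableSet_Icc fun t ht ↦ ?_
          have h1 : mfderivWithin 𝓘(ℝ, ℝ) 𝓘(ℝ, ℝ) (u ∘ γ) (Set.Icc 0 1) t =
              (mfderiv (𝓡 d) 𝓘(ℝ, ℝ) u (γ t)).comp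
                (mfderivWithin 𝓘(ℝ, ℝ) (𝓡 d) γ (Set.Icc 0 1) t) := by
            apply mfderiv_comp_mfderivWithin
            · exact (hu _ (hmem t ht)).mdifferentiableAt one_ne_zero
            · exact (γ_smooth.mdifferentiable one_ne_zero).mdifferentiableOn _ ht
            · rw [uniqueMDiffWithinAt_iff_uniqueDiffWithinAt]
              exact uniqueDiffOn_Icc zero_lt_one _ ht
          have h2 : derivWithin (u ∘ γ) (Set.Icc 0 1) t =
              mfderiv (𝓡 d) 𝓘(ℝ, ℝ) u (γ t)
                (mfderivWithin 𝓘(ℝ, ℝ) (𝓡 d) γ (Set.Icc 0 1) t 1) := by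
            rw [← fderivWithin_derivWithin, ← mfderivWithin_eq_fderivWithin]
            exact DFunLike.congr_fun h1 1
          rw [h2]
          exact hC _ (hmem t ht) _
      _ = C * pathELength (𝓡 d) γ 0 1 := by
          rw [lintegral_const_mul' _ _ ENNReal.coe_ne_top,
            pathELength_eq_lintegral_mfderivWithin_Icc]
      _ ≤ C * R := by gcongr
  obtain ⟨R₀, hR₀, hR₀c⟩ := exists_between hy
  have hlim : Tendsto (fun R : ℝ≥0∞ ↦ (C : ℝ≥0∞) * R) (𝓝[>] (riemannianEDist (𝓡 d) p y))
      (𝓝 (C * riemannianEDist (𝓡 d) p y)) :=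
    (ENNReal.Tendsto.const_mul tendsto_id (Or.inr ENNReal.coe_ne_top)).mono_left
      nhdsWithin_le_nhds
  have : (𝓝[>] (riemannianEDist (𝓡 d) p y)).NeBot :=
    nhdsGT_neBot_of_exists_gt ⟨R₀, hR₀⟩
  refine ge_of_tendsto hlim ?_
  filter_upwards [Ioo_mem_nhdsGT hy] with R hR using key R hR.1 hR.2


/-- Continuity of the metric: near `q` the chart distorts norms by a factor close to 1, provided its
values are measured by the inner product of the tangent space at `q`. The `show` selects that norm
instead of the Euclidean one. -/
theorem eventually_norm_mfderiv_extChartAt_le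
    [IsContinuousRiemannianBundle (EuclideanSpace ℝ (Fin d)) (fun x : M ↦ TangentSpace (𝓡 d) x)]
    (q : M) {r : NNReal} (hr : 1 < r) :
    ∀ᶠ y in 𝓝 q, ∀ v : TangentSpace (𝓡 d) y,
      ‖(show TangentSpace (𝓡 d) q from mfderiv (𝓡 d) (𝓡 d) (extChartAt (𝓡 d) q) y v)‖ ≤ r * ‖v‖ := by
  have h := eventually_norm_symmL_trivializationAt_self_comp_lt (EuclideanSpace ℝ (Fin d))
    (fun x : M ↦ TangentSpace (𝓡 d) x) q (r := r) (by exact_mod_cast hr)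
  filter_upwards [h, chart_source_mem_nhds (EuclideanSpace ℝ (Fin d)) q] with y hy hys v
  rw [TangentBundle.continuousLinearMapAt_trivializationAt hys,
    TangentBundle.symmL_trivializationAt (mem_chart_source _ q),
    mfderivWithin_range_extChartAt_symm] at hy
  exact ContinuousLinearMap.le_of_opNorm_le _ hy.le v

theorem eventually_norm_mfderiv_extChartAt_symm_le
    [IsContinuousRiemannianBundle (EuclideanSpace ℝ (Fin d)) (fun x : M ↦ TangentSpace (𝓡 d) x)]
    (q : M) {r : NNReal} (hr : 1 < r) :
    ∀ᶠ y in 𝓝 (extChartAt (𝓡 d) q q), ∀ v : TangentSpace (𝓡 d) q,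
      ‖mfderiv (𝓡 d) (𝓡 d) (extChartAt (𝓡 d) q).symm y v‖ ≤ r * ‖v‖ := by
  have h := eventually_norm_symmL_trivializationAt_comp_self_lt (EuclideanSpace ℝ (Fin d))
    (fun x : M ↦ TangentSpace (𝓡 d) x) q (r := r) (by exact_mod_cast hr)
  have h' := h.and (chart_source_mem_nhds (EuclideanSpace ℝ (Fin d)) q)
  have hcont := (continuousAt_extChartAt_symm (I := 𝓡 d) q).tendsto
  rw [extChartAt_to_inv] at hcont
  filter_upwards [hcont.eventually h', extChartAt_target_mem_nhds q]
    with y hy hyt v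
  obtain ⟨hy, hys⟩ := hy
  rw [TangentBundle.continuousLinearMapAt_trivializationAt (mem_chart_source _ q),
    TangentBundle.symmL_trivializationAt hys, mfderiv_extChartAt_self,
    (extChartAt (𝓡 d) q).right_inv hyt, show Set.range (𝓡 d) = Set.univ from (𝓡 d).range_eq_univ,
    mfderivWithin_univ] at hy
  exact ContinuousLinearMap.le_of_opNorm_le _ hy.le v

/-- The distance is at most the length of the chart curve itself, whose speed stays below `r * ‖v‖`
for short times by continuity of the metric. -/
theorem eventually_riemannianEDist_chartCurve_le
    [IsContinuousRiemannianBundle (EuclideanSpace ℝ (Fin d)) (fun x : M ↦ TangentSpace (𝓡 d) x)]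
    (p : M) (v : TangentSpace (𝓡 d) p) {r : NNReal} (hr : 1 < r) :
    ∀ᶠ t in 𝓝[>] (0 : ℝ),
      riemannianEDist (𝓡 d) p (chartCurve p v t) ≤ r * ‖v‖ₑ * ENNReal.ofReal t := by
  have hℓ := (contDiff_chartLine (d := d) p v).continuous.continuousAt (x := 0)
  have h := (eventually_norm_mfderiv_extChartAt_symm_le p hr).and
    (extChartAt_target_mem_nhds (I := 𝓡 d) p)
  rw [← chartLine_zero p v] at h
  obtain ⟨ε, hε, hball⟩ := Metric.eventually_nhds_iff.1 (hℓ.eventually h)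
  filter_upwards [Ioo_mem_nhdsGT hε] with t ht
  have hs : ∀ s ∈ Set.Icc (0 : ℝ) t, dist s 0 < ε := fun s hs ↦ by
    rw [Real.dist_eq, sub_zero, abs_of_nonneg hs.1]
    exact hs.2.trans_lt ht.2
  have hsmooth : ContMDiffOn 𝓘(ℝ, ℝ) (𝓡 d) 1 (chartCurve p v) (Set.Icc 0 t) := by
    have h1 : ContMDiffOn 𝓘(ℝ, ℝ) (𝓡 d) 1 (chartLine p v) (Set.Icc 0 t) :=
      (contDiff_chartLine p v).contMDiff.contMDiffOn
    exact (contMDiffOn_extChartAt_symm p).comp h1 fun s hs' ↦ (hball (hs s hs')).2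
  calc riemannianEDist (𝓡 d) p (chartCurve p v t)
      ≤ pathELength (𝓡 d) (chartCurve p v) 0 t :=
        riemannianEDist_le_pathELength hsmooth (chartCurve_zero p v) rfl ht.1.le
    _ ≤ ∫⁻ _ in Set.Icc 0 t, r * ‖v‖ₑ := by
        rw [pathELength_eq_lintegral_mfderiv_Icc]
        refine setLIntegral_mono' measurableSet_Icc fun s hs' ↦ ?_
        have e : mfderiv 𝓘(ℝ, ℝ) (𝓡 d) (chartCurve p v) s 1 =
            mfderiv (𝓡 d) (𝓡 d) (extChartAt (𝓡 d) p).symm (chartLine p v s) v := by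
          rw [(hasMFDerivAt_chartCurve p v (hball (hs s hs')).2).mfderiv]
          exact congrArg _ (one_smul ℝ v)
        rw [e]
        exact enorm_le_coe_mul_enorm ((hball (hs s hs')).1 v)
    _ = r * ‖v‖ₑ * ENNReal.ofReal t := by
        rw [setLIntegral_const, Real.volume_Icc, sub_zero]

/-- Every tangent vector `v` is the velocity of a curve along which the Riemannian distance grows
at rate at most `‖v‖`. -/
theorem exists_curve_riemannianEDist_le
    [IsContinuousRiemannianBundle (EuclideanSpace ℝ (Fin d)) (fun x : M ↦ TangentSpace (𝓡 d) x)]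
    (p : M) (v : TangentSpace (𝓡 d) p) :
    ∃ c : ℝ → M, c 0 = p ∧
      HasMFDerivAt 𝓘(ℝ, ℝ) (𝓡 d) c 0 (ContinuousLinearMap.toSpanSingleton ℝ v) ∧
      ∀ r : NNReal, 1 < r → ∀ᶠ t in 𝓝[>] (0 : ℝ),
        riemannianEDist (𝓡 d) p (c t) ≤ r * ‖v‖ₑ * ENNReal.ofReal t :=
  ⟨chartCurve p v, chartCurve_zero p v, hasMFDerivAt_chartCurve_zero p v,
    fun _ hr ↦ eventually_riemannianEDist_chartCurve_le p v hr⟩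

/-- The differential of a distance-preserving differentiable map does not increase norms. -/
theorem norm_mfderiv_le_of_riemannianEDist_eq [RegularSpace M]
    [IsContinuousRiemannianBundle (EuclideanSpace ℝ (Fin d)) (fun x : M ↦ TangentSpace (𝓡 d) x)]
    {ζ : M → M} {p : M} (hζ : MDifferentiableAt (𝓡 d) (𝓡 d) ζ p)
    (hdist : ∀ y, riemannianEDist (𝓡 d) (ζ p) (ζ y) = riemannianEDist (𝓡 d) p y)
    (v : TangentSpace (𝓡 d) p) : ‖mfderiv (𝓡 d) (𝓡 d) ζ p v‖ ≤ ‖v‖ := by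
  set w : TangentSpace (𝓡 d) (ζ p) := mfderiv (𝓡 d) (𝓡 d) ζ p v with hw
  -- The test function `u` is linear in the chart at `ζ p` and has gradient `w` at `ζ p`.
  -- Differentiating it along the image of a curve with velocity `v` gives `‖w‖ ^ 2`, while the
  -- Lipschitz bound gives at most `‖w‖ * ‖v‖`.
  let L : EuclideanSpace ℝ (Fin d) →L[ℝ] ℝ :=
    (innerSL ℝ w : TangentSpace (𝓡 d) (ζ p) →L[ℝ] ℝ)
  let u : M → ℝ := fun y ↦ L (extChartAt (𝓡 d) (ζ p) y)
  have hLw : L w = ‖w‖ ^ 2 := real_inner_self_eq_norm_sq w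
  obtain ⟨c, hc0, hcurve, hcdist⟩ := exists_curve_riemannianEDist_le p v
  -- One factor `r` is the loss in the Lipschitz constant of `u`, the other the loss in the speed of
  -- the curve; both disappear as `r` tends to 1.
  have key : ∀ r : NNReal, 1 < r → ‖w‖ ^ 2 ≤ r * ‖w‖ * (r * ‖v‖) := by
    intro r hr
    have hu : ∀ᶠ y in 𝓝 (ζ p), ‖u y - u (ζ p)‖ₑ
        ≤ (r * ‖w‖₊ : NNReal) * riemannianEDist (𝓡 d) (ζ p) y := by
      refine eventually_enorm_sub_le_riemannianEDist (d := d)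
        ((eventually_norm_mfderiv_extChartAt_le (d := d) (ζ p) hr).and
          (chart_source_mem_nhds (EuclideanSpace ℝ (Fin d)) (ζ p))) ?_ ?_
      · rintro y ⟨-, hy⟩
        exact L.contMDiff.contMDiffAt.comp y (contMDiffAt_extChartAt' hy)
      · rintro y ⟨hy, hys⟩ v'
        have h1 := hasMFDerivAt_comp_extChartAt hys L
        have h2 : |realDifferential u y v'| ≤ (r * ‖w‖₊ : NNReal) * ‖v'‖ := by
          have h3 : realDifferential u y v' = inner ℝ w (show TangentSpace (𝓡 d) (ζ p) from
              mfderiv (𝓡 d) (𝓡 d) (extChartAt (𝓡 d) (ζ p)) y v') := by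
            rw [realDifferential, h1.mfderiv]; rfl
          rw [h3]
          refine (abs_real_inner_le_norm _ _).trans ?_
          push_cast
          calc _ ≤ ‖w‖ * (r * ‖v'‖) := by gcongr; exact hy v'
            _ = _ := by ring
        exact enorm_le_coe_mul_enorm h2
    have hcont : Tendsto (fun t ↦ ζ (c t)) (𝓝[>] 0) (𝓝 (ζ p)) := by
      have h1 : ContinuousAt ζ (c 0) := by
        rw [hc0]; exact hζ.continuousAt
      have := (h1.comp (hcurve.continuousAt :)).tendsto
      rw [Function.comp_apply, hc0] at this
      exact this.mono_left nhdsWithin_le_nhds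
    have hderiv : HasDerivAt (fun t ↦ u (ζ (c t))) (‖w‖ ^ 2) 0 := by
      have h1 : HasMFDerivAt (𝓡 d) (𝓡 d) ζ (c 0) (mfderiv (𝓡 d) (𝓡 d) ζ p) := by
        rw [hc0]; exact hζ.hasMFDerivAt
      have h2 : HasMFDerivAt (𝓡 d) 𝓘(ℝ, ℝ) u (ζ (c 0)) L := by
        rw [hc0]
        have := hasMFDerivAt_comp_extChartAt (mem_chart_source _ (ζ p)) L
        rwa [mfderiv_extChartAt_self] at this
      have h3 := ((h2.comp _ h1).comp 0 hcurve).hasFDerivAt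
      rw [hasDerivAt_iff_hasFDerivAt]
      have h4 : L (mfderiv (𝓡 d) (𝓡 d) ζ p ((1 : ℝ) • v)) = (1 : ℝ) • ‖w‖ ^ 2 := by
        rw [one_smul, one_smul, ← hLw]
      exact h3.congr_fderiv (ContinuousLinearMap.ext_ring h4)
    -- Only the right-hand slope is used, since the distance along the curve is controlled for
    -- positive times.
    have hslope := (hasDerivAt_iff_tendsto_slope_zero.1 hderiv).mono_left
      (nhdsWithin_mono (0 : ℝ) fun t (ht : t ∈ Set.Ioi 0) ↦ ne_of_gt ht)
    refine le_of_tendsto hslope ?_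
    filter_upwards [hcont.eventually hu, hcdist r hr,
      self_mem_nhdsWithin] with t h1 h2 (ht : 0 < t)
    rw [hdist] at h1
    have h3 := h1.trans (mul_le_mul_right h2 _)
    rw [← ofReal_norm, ← ofReal_norm, ← ENNReal.ofReal_coe_nnreal,
      ← ENNReal.ofReal_coe_nnreal, ← ENNReal.ofReal_mul (NNReal.coe_nonneg r),
      ← ENNReal.ofReal_mul (by positivity), ← ENNReal.ofReal_mul (NNReal.coe_nonneg _),
      ENNReal.ofReal_le_ofReal_iff (by positivity)] at h3
    rw [zero_add, hc0, smul_eq_mul, inv_mul_le_iff₀ ht]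
    refine (le_abs_self _).trans (h3.trans_eq ?_)
    push_cast
    ring
  have hlim : Tendsto (fun r : NNReal ↦ (r : ℝ) * ‖w‖ * (r * ‖v‖)) (𝓝[>] 1)
      (𝓝 ((1 : NNReal) * ‖w‖ * ((1 : NNReal) * ‖v‖))) :=
    (Continuous.tendsto (by fun_prop) 1).mono_left nhdsWithin_le_nhds
  have hfin : ‖w‖ ^ 2 ≤ ‖w‖ * ‖v‖ := by
    have := ge_of_tendsto hlim (eventually_mem_nhdsWithin.mono key)
    simpa using this
  rcases (norm_nonneg w).eq_or_lt with h0 | h0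
  · rw [← h0]; exact norm_nonneg v
  · nlinarith

/-- The differential of a distance-preserving diffeomorphism preserves norms. -/
theorem IsIsometry.norm_mfderiv [RegularSpace M]
    [IsContinuousRiemannianBundle (EuclideanSpace ℝ (Fin d)) (fun x : M ↦ TangentSpace (𝓡 d) x)]
    {ζ : M ≃ₘ⟮𝓡 d, 𝓡 d⟯ M} (hζ : IsIsometry d ζ) (p : M) (v : TangentSpace (𝓡 d) p) :
    ‖mfderiv (𝓡 d) (𝓡 d) ζ p v‖ = ‖v‖ := by
  have hd : MDifferentiable (𝓡 d) (𝓡 d) ζ := ζ.mdifferentiable (by simp)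
  have hd' : MDifferentiable (𝓡 d) (𝓡 d) ζ.symm := ζ.symm.mdifferentiable (by simp)
  refine le_antisymm (norm_mfderiv_le_of_riemannianEDist_eq (hd p) (hζ p) v) ?_
  have h1 := norm_mfderiv_le_of_riemannianEDist_eq (ζ := ζ.symm) (hd' (ζ p))
    (fun y ↦ by rw [← hζ, ζ.apply_symm_apply, ζ.apply_symm_apply]) (mfderiv (𝓡 d) (𝓡 d) ζ p v)
  have h2 := (mfderiv_comp p (hd' (ζ p)) (hd p)).symm
  rw [show (ζ.symm ∘ ζ : M → M) = id from funext ζ.symm_apply_apply, mfderiv_id] at h2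
  -- The vector obtained from the chain rule is based at `ζ.symm (ζ p)`, which equals `p` only
  -- propositionally, so the norm has to be transported between tangent spaces.
  have h3 : ∀ x : M, x = p → ∀ z : TangentSpace (𝓡 d) x, z = v → ‖z‖ = ‖v‖ := by
    rintro x rfl z rfl
    rfl
  rw [← h3 _ (ζ.symm_apply_apply p) _ (DFunLike.congr_fun h2 v)]
  exact h1

end Differential

/-! ### Invariance of the Riemannian volume -/

section Volume

variable {d : ℕ} {M : Type*} [TopologicalSpace M] [ChartedSpace (EuclideanSpace ℝ (Fin d)) M]

theorem transOpenPartialHomeomorph_mem_maximalAtlas [IsManifold (𝓡 d) ∞ M]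
    (ζ : M ≃ₘ⟮𝓡 d, 𝓡 d⟯ M) {e : OpenPartialHomeomorph M (EuclideanSpace ℝ (Fin d))}
    (he : e ∈ IsManifold.maximalAtlas (𝓡 d) ∞ M) :
    ζ.toHomeomorph.transOpenPartialHomeomorph e ∈ IsManifold.maximalAtlas (𝓡 d) ∞ M := by
  rw [IsManifold.mem_maximalAtlas_iff_contMDiffOn] at he ⊢
  refine ⟨?_, ?_⟩
  · exact he.1.comp ζ.contMDiff.contMDiffOn fun x hx ↦ hx
  · exact ζ.symm.contMDiff.comp_contMDiffOn he.2

variable [RiemannianBundle (fun x : M ↦ TangentSpace (𝓡 d) x)]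

theorem IsIsometry.symm {ζ : M ≃ₘ⟮𝓡 d, 𝓡 d⟯ M} (hζ : IsIsometry d ζ) : IsIsometry d ζ.symm :=
  fun x y ↦ by rw [← hζ, ζ.apply_symm_apply, ζ.apply_symm_apply]

variable [IsManifold (𝓡 d) ∞ M] [RegularSpace M]
  [IsContinuousRiemannianBundle (EuclideanSpace ℝ (Fin d)) (fun x : M ↦ TangentSpace (𝓡 d) x)]

theorem IsIsometry.inner_mfderiv {ζ : M ≃ₘ⟮𝓡 d, 𝓡 d⟯ M} (hζ : IsIsometry d ζ) (p : M)
    (v w : TangentSpace (𝓡 d) p) :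
    ⟪mfderiv (𝓡 d) (𝓡 d) ζ p v, mfderiv (𝓡 d) (𝓡 d) ζ p w⟫_ℝ = ⟪v, w⟫_ℝ :=
  LinearIsometry.inner_map_map
    (⟨(mfderiv (𝓡 d) (𝓡 d) ζ p).toLinearMap, hζ.norm_mfderiv p⟩ :
      TangentSpace (𝓡 d) p →ₗᵢ[ℝ] TangentSpace (𝓡 d) (ζ p)) v w

/-- The coordinate fields of the chart `e ∘ ζ` are the images under the differential of `ζ.symm` of
those of `e`, and that differential preserves inner products. -/
theorem IsIsometry.gramMatrix_eq {ζ : M ≃ₘ⟮𝓡 d, 𝓡 d⟯ M} (hζ : IsIsometry d ζ)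
    {e : OpenPartialHomeomorph M (EuclideanSpace ℝ (Fin d))}
    (he : e ∈ IsManifold.maximalAtlas (𝓡 d) ∞ M) {y : EuclideanSpace ℝ (Fin d)}
    (hy : y ∈ e.target) :
    gramMatrix (ζ.toHomeomorph.transOpenPartialHomeomorph e) y = gramMatrix e y := by
  have hd : MDifferentiable (𝓡 d) (𝓡 d) ζ.symm := ζ.symm.mdifferentiable (by simp)
  have h : ∀ i, coordVector (ζ.toHomeomorph.transOpenPartialHomeomorph e) y i =
      mfderiv (𝓡 d) (𝓡 d) ζ.symm (e.symm y) (coordVector e y i) := by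
    intro i
    have := mfderiv_comp y (hd (e.symm y))
      ((contMDiffAt_symm_of_mem_maximalAtlas he hy).mdifferentiableAt (by simp))
    exact DFunLike.congr_fun this (EuclideanSpace.single i (1 : ℝ))
  ext i j
  have h2 := hζ.symm.inner_mfderiv (e.symm y) (coordVector e y i) (coordVector e y j)
  rw [gramMatrix, gramMatrix, Matrix.of_apply, Matrix.of_apply, h i, h j]
  exact h2

variable [MeasurableSpace M] [BorelSpace M]

theorem IsIsometry.chartVolume_eq {ζ : M ≃ₘ⟮𝓡 d, 𝓡 d⟯ M} (hζ : IsIsometry d ζ)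
    {e : OpenPartialHomeomorph M (EuclideanSpace ℝ (Fin d))}
    (he : e ∈ IsManifold.maximalAtlas (𝓡 d) ∞ M) :
    (chartVolume (ζ.toHomeomorph.transOpenPartialHomeomorph e)).map ζ = chartVolume e := by
  have hζm : Measurable ζ := ζ.continuous.measurable
  have hdens : ((volume : Measure (EuclideanSpace ℝ (Fin d))).restrict e.target).withDensity
      (fun y ↦ ENNReal.ofReal (√(gramMatrix (ζ.toHomeomorph.transOpenPartialHomeomorph e) y).det))
      = ((volume : Measure (EuclideanSpace ℝ (Fin d))).restrict e.target).withDensity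
      (fun y ↦ ENNReal.ofReal (√(gramMatrix e y).det)) := by
    refine withDensity_congr_ae ?_
    filter_upwards [ae_restrict_mem e.open_target.measurableSet] with y hy
    rw [hζ.gramMatrix_eq he hy]
  have hmeas : AEMeasurable (ζ.toHomeomorph.transOpenPartialHomeomorph e).symm
      (((volume : Measure (EuclideanSpace ℝ (Fin d))).restrict e.target).withDensity
      (fun y ↦ ENNReal.ofReal (√(gramMatrix e y).det))) :=
    ((ζ.toHomeomorph.transOpenPartialHomeomorph e).continuousOn_symm.aemeasurable
      e.open_target.measurableSet).mono_ac (withDensity_absolutelyContinuous _ _)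
  rw [chartVolume, chartVolume]
  -- The chart `e ∘ ζ` has the same target as `e`, and its inverse is `ζ.symm ∘ e.symm`, both by
  -- definition.
  change ((((volume : Measure (EuclideanSpace ℝ (Fin d))).restrict e.target).withDensity
      _).map _).map ζ = _
  rw [hdens, AEMeasurable.map_map_of_aemeasurable hζm.aemeasurable hmeas]
  congr 1
  funext y
  exact ζ.apply_symm_apply _

/-- Precomposition with `ζ` maps the maximal atlas into itself, so each chart measure in the
supremum is the image of another one. -/
theorem IsIsometry.riemannianVolume_le_map {ζ : M ≃ₘ⟮𝓡 d, 𝓡 d⟯ M} (hζ : IsIsometry d ζ) :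
    riemannianVolume d M ≤ (riemannianVolume d M).map ζ := by
  refine iSup₂_le fun e he ↦ ?_
  rw [← hζ.chartVolume_eq he]
  exact Measure.map_mono
    (le_iSup₂_of_le _ (transOpenPartialHomeomorph_mem_maximalAtlas ζ he) le_rfl)
    ζ.continuous.measurable

/-- Isometries preserve the Riemannian volume. -/
theorem IsIsometry.measurePreserving {ζ : M ≃ₘ⟮𝓡 d, 𝓡 d⟯ M} (hζ : IsIsometry d ζ) :
    MeasurePreserving ζ (riemannianVolume d M) (riemannianVolume d M) := by
  refine ⟨ζ.continuous.measurable, le_antisymm ?_ hζ.riemannianVolume_le_map⟩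
  -- The reverse inequality is the one for `ζ.symm`, pushed forward by `ζ`.
  have h := Measure.map_mono hζ.symm.riemannianVolume_le_map ζ.continuous.measurable
  rwa [Measure.map_map ζ.continuous.measurable ζ.symm.continuous.measurable,
    show (ζ ∘ ζ.symm : M → M) = id from funext ζ.apply_symm_apply, Measure.map_id] at h

end Volume

/-! ### Eigenfunctions: orthogonality and invariance under isometries -/

section Laplacian

/-- The sum `∑ i, A (b i) * conj (B (b i))` does not depend on the orthonormal basis `b`. -/
theorem sum_mul_conj_orthonormalBasis_eq {E ι κ : Type*} [NormedAddCommGroup E]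
    [InnerProductSpace ℝ E] [Fintype ι] [Fintype κ] (b : OrthonormalBasis ι ℝ E)
    (c : OrthonormalBasis κ ℝ E) (A B : E →ₗ[ℝ] ℂ) :
    ∑ i, A (b i) * conj (B (b i)) = ∑ j, A (c j) * conj (B (c j)) := by
  have hA : ∀ i, A (b i) = ∑ j, (⟪c j, b i⟫_ℝ : ℂ) * A (c j) := fun i ↦ by
    conv_lhs => rw [← c.sum_repr' (b i)]
    simp
  have hB : ∀ j, B (c j) = ∑ i, (⟪c j, b i⟫_ℝ : ℂ) * B (b i) := fun j ↦ by
    conv_lhs => rw [← b.sum_repr' (c j)]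
    simp [real_inner_comm]
  simp_rw [hA, hB, map_sum, Finset.sum_mul, Finset.mul_sum, map_mul, Complex.conj_ofReal]
  rw [Finset.sum_comm]
  exact Finset.sum_congr rfl fun j _ ↦ Finset.sum_congr rfl fun i _ ↦ by ring

variable {d : ℕ} {M : Type*} [TopologicalSpace M] [ChartedSpace (EuclideanSpace ℝ (Fin d)) M]

theorem differential_comp {ζ : M ≃ₘ⟮𝓡 d, 𝓡 d⟯ M} {u : M → ℂ}
    (hu : MDifferentiable (𝓡 d) 𝓘(ℝ, ℂ) u) (x : M) (v : TangentSpace (𝓡 d) x) :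
    differential d (u ∘ ζ) x v = differential d u (ζ x) (mfderiv (𝓡 d) (𝓡 d) ζ x v) := by
  have := mfderiv_comp x (hu (ζ x)) (ζ.mdifferentiable (by simp) x)
  exact DFunLike.congr_fun this v

variable [RiemannianBundle (fun x : M ↦ TangentSpace (𝓡 d) x)]

/-- The Hermitian inner product of two gradients can be computed in any orthonormal basis. -/
theorem gradInner_eq_sum {ι : Type*} [Fintype ι] (u w : M → ℂ) (x : M)
    (b : OrthonormalBasis ι ℝ (TangentSpace (𝓡 d) x)) :
    gradInner d u w x = ∑ i, differential d u x (b i) * conj (differential d w x (b i)) :=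
  sum_mul_conj_orthonormalBasis_eq _ b
    (mfderiv (𝓡 d) 𝓘(ℝ, ℂ) u x : TangentSpace (𝓡 d) x →L[ℝ] ℂ).toLinearMap
    (mfderiv (𝓡 d) 𝓘(ℝ, ℂ) w x : TangentSpace (𝓡 d) x →L[ℝ] ℂ).toLinearMap

theorem conj_gradInner (u w : M → ℂ) (x : M) :
    conj (gradInner d u w x) = gradInner d w u x := by
  simp only [gradInner, map_sum, map_mul, Complex.conj_conj]
  exact Finset.sum_congr rfl fun i _ ↦ mul_comm _ _


section Orthogonality

variable [MeasurableSpace M]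

/-- Eigenfunctions with different eigenvalues are orthogonal. -/
theorem IsEigenfunction.integral_conj_mul_eq_zero {lam mu : ℝ} {φ ψ : M → ℂ}
    (hφ : IsEigenfunction d lam φ) (hψ : IsEigenfunction d mu ψ) (h : lam ≠ mu) :
    ∫ x, conj (φ x) * ψ x ∂(riemannianVolume d M) = 0 := by
  set I := ∫ x, conj (φ x) * ψ x ∂(riemannianVolume d M) with hI
  -- Conjugating the weak equation of `φ` tested against `ψ` turns its right side into that of the
  -- equation of `ψ` tested against `φ`; as the eigenvalues are real, this gives `lam * I = mu * I`.
  have h1 := congrArg conj (hφ.2.integral_eq ψ hψ.2.smooth)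
  rw [map_neg, ← integral_conj, ← integral_conj] at h1
  simp_rw [conj_gradInner] at h1
  rw [← hψ.2.integral_eq φ hφ.2.smooth] at h1
  have h2 : ∀ x, conj (-((lam : ℂ) * φ x) * conj (ψ x)) = -(lam : ℂ) * (conj (φ x) * ψ x) :=
    fun x ↦ by simp [mul_assoc]
  have h3 : ∀ x, -((mu : ℂ) * ψ x) * conj (φ x) = -(mu : ℂ) * (conj (φ x) * ψ x) :=
    fun x ↦ by ring
  simp_rw [h2, h3, integral_const_mul, ← hI] at h1
  have h4 : ((lam : ℂ) - mu) * I = 0 := by linear_combination -h1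
  refine (mul_eq_zero.1 h4).resolve_left (sub_ne_zero.2 ?_)
  exact_mod_cast h

end Orthogonality

variable [IsManifold (𝓡 d) ∞ M] [RegularSpace M]
  [IsContinuousRiemannianBundle (EuclideanSpace ℝ (Fin d)) (fun x : M ↦ TangentSpace (𝓡 d) x)]

/-- The differential of `ζ` maps an orthonormal basis at `x` to one at `ζ x`, and `gradInner` may be
computed in the latter. -/
theorem IsIsometry.gradInner_comp {ζ : M ≃ₘ⟮𝓡 d, 𝓡 d⟯ M} (hζ : IsIsometry d ζ) {u w : M → ℂ}
    (hu : MDifferentiable (𝓡 d) 𝓘(ℝ, ℂ) u) (hw : MDifferentiable (𝓡 d) 𝓘(ℝ, ℂ) w) (x : M) :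
    gradInner d (u ∘ ζ) (w ∘ ζ) x = gradInner d u w (ζ x) := by
  let L : TangentSpace (𝓡 d) x →ₗᵢ[ℝ] TangentSpace (𝓡 d) (ζ x) :=
    ⟨(mfderiv (𝓡 d) (𝓡 d) ζ x).toLinearMap, hζ.norm_mfderiv x⟩
  let b := (stdOrthonormalBasis ℝ (TangentSpace (𝓡 d) x)).map (L.toLinearIsometryEquiv rfl)
  rw [gradInner_eq_sum u w (ζ x) b, gradInner]
  refine Finset.sum_congr rfl fun i _ ↦ ?_
  rw [differential_comp hu, differential_comp hw]
  rfl

variable [MeasurableSpace M] [BorelSpace M]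

theorem IsIsometry.integral_comp {ζ : M ≃ₘ⟮𝓡 d, 𝓡 d⟯ M} (hζ : IsIsometry d ζ) (f : M → ℂ) :
    ∫ x, f (ζ x) ∂(riemannianVolume d M) = ∫ x, f x ∂(riemannianVolume d M) :=
  hζ.measurePreserving.integral_comp ζ.toHomeomorph.measurableEmbedding f

theorem IsLaplaceBeltrami.comp_isometry {u w : M → ℂ} (h : IsLaplaceBeltrami d u w)
    {ζ : M ≃ₘ⟮𝓡 d, 𝓡 d⟯ M} (hζ : IsIsometry d ζ) :
    IsLaplaceBeltrami d (u ∘ ζ) (w ∘ ζ) where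
  smooth := h.smooth.comp ζ.contMDiff
  smooth_laplacian := h.smooth_laplacian.comp ζ.contMDiff
  integral_eq ψ hψ := by
    -- The equation for `u` is tested against `ψ ∘ ζ.symm`, and both integrals are then pulled back
    -- by `ζ`.
    have hψ' : ContMDiff (𝓡 d) 𝓘(ℝ, ℂ) ∞ (ψ ∘ ζ.symm) := hψ.comp ζ.symm.contMDiff
    have hψζ : (ψ ∘ ζ.symm) ∘ ζ = ψ := funext fun x ↦ congrArg ψ (ζ.symm_apply_apply x)
    have h1 := h.integral_eq _ hψ'
    rw [← hζ.integral_comp, ← hζ.integral_comp (gradInner d u (ψ ∘ ζ.symm))] at h1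
    simp_rw [← hζ.gradInner_comp (h.smooth.mdifferentiable (by simp))
      (hψ'.mdifferentiable (by simp)), hψζ] at h1
    rw [← h1]
    simp

theorem IsEigenfunction.comp_isometry {lam : ℝ} {φ : M → ℂ} (h : IsEigenfunction d lam φ)
    {ζ : M ≃ₘ⟮𝓡 d, 𝓡 d⟯ M} (hζ : IsIsometry d ζ) : IsEigenfunction d lam (φ ∘ ζ) :=
  ⟨fun h0 ↦ h.1 (funext fun x ↦ by simpa using congrFun h0 (ζ.symm x)),
    h.2.comp_isometry hζ⟩

end Laplacian

namespace LaplaceEigenbasis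

/-! ### The spectral operator in terms of Fourier coefficients -/

section Coefficients

variable {d : ℕ} {M : Type*} [TopologicalSpace M] [ChartedSpace (EuclideanSpace ℝ (Fin d)) M]
  [RiemannianBundle (fun x : M ↦ TangentSpace (𝓡 d) x)] [MeasurableSpace M]
  (B : LaplaceEigenbasis d M)

theorem memLp_φ (k : ℕ) : MemLp (B.φ k) 2 (riemannianVolume d M) :=
  (Lp.memLp (B.basis k)).ae_eq (B.basis_ae_eq k)

theorem toLp_φ (k : ℕ) : (B.memLp_φ k).toLp (B.φ k) = B.basis k := by
  rw [← Lp.toLp_coeFn (B.basis k) (Lp.memLp _)]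
  exact MemLp.toLp_congr _ _ (B.basis_ae_eq k).symm

theorem inner_toLp {f g : M → ℂ} (hf : MemLp f 2 (riemannianVolume d M))
    (hg : MemLp g 2 (riemannianVolume d M)) :
    ⟪hf.toLp f, hg.toLp g⟫_ℂ = ∫ x, conj (f x) * g x ∂(riemannianVolume d M) := by
  rw [L2.inner_def]
  refine integral_congr_ae ?_
  filter_upwards [hf.coeFn_toLp, hg.coeFn_toLp] with x h1 h2
  rw [h1, h2, RCLike.inner_apply, mul_comm]

/-- The Fourier coefficients with respect to an eigenbasis. -/
def coeff (f : M → ℂ) (k : ℕ) : ℂ := ∫ y, conj (B.φ k y) * f y ∂(riemannianVolume d M)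

theorem inner_basis_toLp {f : M → ℂ} (hf : MemLp f 2 (riemannianVolume d M)) (k : ℕ) :
    ⟪B.basis k, hf.toLp f⟫_ℂ = B.coeff f k := by
  rw [← toLp_φ, inner_toLp, coeff]

theorem integrable_conj_φ_mul {f : M → ℂ} (hf : MemLp f 2 (riemannianVolume d M)) (k : ℕ) :
    Integrable (fun y ↦ conj (B.φ k y) * f y) (riemannianVolume d M) :=
  (B.memLp_φ k).star.integrable_mul hf

theorem integral_kernel_mul (η : eigenvalueSet d M → ℝ) {f : M → ℂ}
    (hf : MemLp f 2 (riemannianVolume d M)) (N : ℕ) (x : M) :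
    ∫ y, B.kernel η N x y * f y ∂(riemannianVolume d M) =
      ∑ k ∈ Finset.range N, (η (B.eigenvalue k) * B.coeff f k) * B.φ k x := by
  have h : ∀ y, B.kernel η N x y * f y = ∑ k ∈ Finset.range N,
      ((η (B.eigenvalue k) : ℂ) * B.φ k x) * (conj (B.φ k y) * f y) := fun y ↦ by
    rw [kernel, Finset.sum_mul]
    exact Finset.sum_congr rfl fun k _ ↦ by ring
  simp_rw [h]
  rw [integral_finsetSum _ fun k _ ↦ (B.integrable_conj_φ_mul hf k).const_mul _]
  refine Finset.sum_congr rfl fun k _ ↦ ?_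
  rw [integral_const_mul, coeff]
  ring

theorem coeFn_sum_smul_basis (a : ℕ → ℂ) (N : ℕ) :
    (fun x ↦ ∑ k ∈ Finset.range N, a k * B.φ k x) =ᵐ[riemannianVolume d M]
      (∑ k ∈ Finset.range N, a k • B.basis k : Lp ℂ 2 (riemannianVolume d M)) := by
  induction N with
  | zero =>
    simp only [Finset.range_zero, Finset.sum_empty]
    exact (Lp.coeFn_zero _ _ _).symm
  | succ N ih =>
    simp only [Finset.sum_range_succ]
    filter_upwards [ih, B.basis_ae_eq N, Lp.coeFn_smul (a N) (B.basis N),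
      Lp.coeFn_add (∑ k ∈ Finset.range N, a k • B.basis k) (a N • B.basis N)] with x h1 h2 h3 h4
    rw [h4, Pi.add_apply, h3, Pi.smul_apply, h2, h1, smul_eq_mul]

/-- The eigenfunction expansion of `T_η` in terms of Fourier coefficients. -/
theorem isImage_iff (η : eigenvalueSet d M → ℝ) {f g : M → ℂ}
    (hf : MemLp f 2 (riemannianVolume d M)) :
    B.IsImage η f g ↔ MemLp g 2 (riemannianVolume d M) ∧
      ∀ k, B.coeff g k = η (B.eigenvalue k) * B.coeff f k := by
  refine and_congr_right fun hg ↦ ?_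
  let S : ℕ → Lp ℂ 2 (riemannianVolume d M) := fun N ↦
    ∑ k ∈ Finset.range N, (η (B.eigenvalue k) * B.coeff f k : ℂ) • B.basis k
  have hS : (fun N : ℕ ↦ eLpNorm
      (fun x ↦ (∫ y, B.kernel η N x y * f y ∂(riemannianVolume d M)) - g x)
      2 (riemannianVolume d M)) = fun N ↦ eLpNorm (⇑(S N) - g) 2 (riemannianVolume d M) := by
    funext N
    refine eLpNorm_congr_ae ?_
    simp_rw [B.integral_kernel_mul η hf]
    exact (B.coeFn_sum_smul_basis _ N).sub EventuallyEq.rfl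
  rw [hS, ← Lp.tendsto_Lp_iff_tendsto_eLpNorm S g hg]
  constructor
  -- The `j`-th coefficient of the partial sums is constant once `N > j`, so the limit has this
  -- coefficient.
  · intro h j
    have h1 : Tendsto (fun N ↦ ⟪B.basis j, S N⟫_ℂ) atTop (𝓝 ⟪B.basis j, hg.toLp g⟫_ℂ) :=
      tendsto_const_nhds.inner h
    rw [B.inner_basis_toLp hg] at h1
    refine tendsto_nhds_unique h1 (tendsto_const_nhds.congr' ?_)
    filter_upwards [eventually_gt_atTop j] with N hN
    simp_rw [S, inner_sum, inner_smul_right, orthonormal_iff_ite.1 B.basis.orthonormal]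
    simp [hN]
  -- With the prescribed coefficients, the partial sums are those of the Hilbert basis expansion of
  -- `g`.
  · intro h
    have h1 := (B.basis.hasSum_repr (hg.toLp g)).tendsto_sum_nat
    simp_rw [B.basis.repr_apply_apply, B.inner_basis_toLp, h] at h1
    exact h1

theorem ae_eq_of_coeff_eq {f g : M → ℂ} (hf : MemLp f 2 (riemannianVolume d M))
    (hg : MemLp g 2 (riemannianVolume d M)) (h : ∀ k, B.coeff f k = B.coeff g k) :
    f =ᵐ[riemannianVolume d M] g := by
  rw [← MemLp.toLp_eq_toLp_iff hf hg]
  refine B.basis.repr.injective (lp.ext (funext fun k ↦ ?_))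
  rw [B.basis.repr_apply_apply, B.basis.repr_apply_apply, inner_basis_toLp, inner_basis_toLp, h]

theorem IsImage.ae_eq {η : eigenvalueSet d M → ℝ} {f g g' : M → ℂ}
    (hf : MemLp f 2 (riemannianVolume d M)) (h : B.IsImage η f g) (h' : B.IsImage η f g') :
    g =ᵐ[riemannianVolume d M] g' := by
  rw [B.isImage_iff η hf] at h h'
  exact B.ae_eq_of_coeff_eq h.1 h'.1 fun k ↦ by rw [h.2, h'.2]

/-- If `η` is bounded, then `T_η` is defined on all of `L²`. -/
theorem inDomain_of_bounded {η : eigenvalueSet d M → ℝ} {C : ℝ} (hC : ∀ l, |η l| ≤ C)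
    {f : M → ℂ} (hf : MemLp f 2 (riemannianVolume d M)) : B.InDomain η f := by
  -- The candidate coefficients are square summable by comparison with `C` times those of `f`; the
  -- Hilbert basis then produces the image `G`.
  have hmem : Memℓp (fun k ↦ (η (B.eigenvalue k) : ℂ) * B.basis.repr (hf.toLp f) k) 2 := by
    have h1 : Memℓp (fun k ↦ (C : ℂ) • B.basis.repr (hf.toLp f) k) 2 :=
      (lp.memℓp (B.basis.repr (hf.toLp f))).const_smul (C : ℂ)
    refine memℓp_gen (Summable.of_nonneg_of_le (fun k ↦ by positivity) (fun k ↦ ?_)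
      (h1.summable (by norm_num)))
    have hC0 : 0 ≤ C := (abs_nonneg _).trans (hC (B.eigenvalue k))
    gcongr
    rw [smul_eq_mul, norm_mul, norm_mul, Complex.norm_real, Complex.norm_real, Real.norm_eq_abs,
      Real.norm_eq_abs, abs_of_nonneg hC0]
    gcongr
    exact hC _
  let G : Lp ℂ 2 (riemannianVolume d M) := B.basis.repr.symm ⟨_, hmem⟩
  refine ⟨G, (B.isImage_iff η hf).2 ⟨Lp.memLp G, fun k ↦ ?_⟩⟩
  rw [← B.inner_basis_toLp (Lp.memLp G), Lp.toLp_coeFn, ← B.basis.repr_apply_apply,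
    ← B.inner_basis_toLp hf, ← B.basis.repr_apply_apply, LinearIsometryEquiv.apply_symm_apply]

theorem isImage_spectralOperator {η : eigenvalueSet d M → ℝ} {f : M → ℂ}
    (h : B.InDomain η f) : B.IsImage η f (B.spectralOperator η f) := by
  rw [spectralOperator, dif_pos h]
  exact h.choose_spec

end Coefficients

/-! ### Commutation with isometries -/

section Isometry

variable {d : ℕ} {M : Type*} [TopologicalSpace M] [ChartedSpace (EuclideanSpace ℝ (Fin d)) M]
  [RiemannianBundle (fun x : M ↦ TangentSpace (𝓡 d) x)] [MeasurableSpace M]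
  [IsManifold (𝓡 d) ∞ M] [RegularSpace M] [BorelSpace M]
  [IsContinuousRiemannianBundle (EuclideanSpace ℝ (Fin d)) (fun x : M ↦ TangentSpace (𝓡 d) x)]
  (B : LaplaceEigenbasis d M)

theorem coeff_pushforward {ζ : M ≃ₘ⟮𝓡 d, 𝓡 d⟯ M} (hζ : IsIsometry d ζ) (f : M → ℂ) (k : ℕ) :
    B.coeff (pushforward ζ f) k = ∫ y, conj (B.φ k (ζ y)) * f y ∂(riemannianVolume d M) := by
  rw [coeff, ← hζ.integral_comp]
  simp [pushforward]

theorem memLp_pushforward {ζ : M ≃ₘ⟮𝓡 d, 𝓡 d⟯ M} (hζ : IsIsometry d ζ) {f : M → ℂ}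
    (hf : MemLp f 2 (riemannianVolume d M)) : MemLp (pushforward ζ f) 2 (riemannianVolume d M) :=
  hf.comp_measurePreserving hζ.symm.measurePreserving

/-- `T_η` commutes with isometries. -/
theorem IsImage.pushforward {η : eigenvalueSet d M → ℝ} {ζ : M ≃ₘ⟮𝓡 d, 𝓡 d⟯ M}
    (hζ : IsIsometry d ζ) {f g : M → ℂ} (hf : MemLp f 2 (riemannianVolume d M))
    (h : B.IsImage η f g) : B.IsImage η (pushforward ζ f) (pushforward ζ g) := by
  rw [B.isImage_iff η hf] at h
  obtain ⟨hg, h⟩ := h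
  refine (B.isImage_iff η (memLp_pushforward hζ hf)).2 ⟨memLp_pushforward hζ hg, fun k ↦ ?_⟩
  have hφ : MemLp (B.φ k ∘ ζ) 2 (riemannianVolume d M) :=
    (B.memLp_φ k).comp_measurePreserving hζ.measurePreserving
  -- Parseval for `φ_k ∘ ζ` and `F`: this is the `k`-th row of the matrix of $V_\zeta$ applied to
  -- the coefficients of `F`.
  have hcoeff : ∀ {F : M → ℂ} (hF : MemLp F 2 (riemannianVolume d M)),
      B.coeff (SpectralGeometry.pushforward ζ F) k =
        ∑' j, ⟪hφ.toLp _, B.basis j⟫_ℂ * B.coeff F j := fun {F} hF ↦ by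
    rw [B.coeff_pushforward hζ]
    refine (inner_toLp hφ hF).symm.trans ?_
    rw [← B.basis.tsum_inner_mul_inner]
    simp_rw [B.inner_basis_toLp hF]
  rw [hcoeff hg, hcoeff hf, ← tsum_mul_left]
  refine tsum_congr fun j ↦ ?_
  -- The matrix is block diagonal: within a block `η` takes a single value, and outside the blocks
  -- the entry is an inner product of eigenfunctions with different eigenvalues.
  by_cases hjk : B.lam j = B.lam k
  · have he : B.eigenvalue j = B.eigenvalue k := Subtype.ext hjk
    rw [h, he]
    ring
  · have h0 : ⟪hφ.toLp _, B.basis j⟫_ℂ = 0 := by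
      rw [← toLp_φ, inner_toLp]
      exact ((B.isEigenfunction k).comp_isometry hζ).integral_conj_mul_eq_zero
        (B.isEigenfunction j) (Ne.symm hjk)
    rw [h0, zero_mul, zero_mul, mul_zero]

theorem inDomain_pushforward_iff {η : eigenvalueSet d M → ℝ} {ζ : M ≃ₘ⟮𝓡 d, 𝓡 d⟯ M}
    (hζ : IsIsometry d ζ) {f : M → ℂ} (hf : MemLp f 2 (riemannianVolume d M)) :
    B.InDomain η (pushforward ζ f) ↔ B.InDomain η f := by
  refine ⟨fun ⟨g, hg⟩ ↦ ⟨pushforward ζ.symm g, ?_⟩, fun ⟨g, hg⟩ ↦ ⟨_, hg.pushforward B hζ hf⟩⟩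
  have := hg.pushforward B hζ.symm (memLp_pushforward hζ hf)
  rwa [show pushforward ζ.symm (pushforward ζ f) = f from
    funext fun x ↦ congrArg f (ζ.symm_apply_apply x)] at this

/-- On the domain this is uniqueness of the image up to null sets. Off the domain both sides are the
default value `0`, because the domain is invariant, so no domain hypothesis is needed. -/
theorem spectralOperator_pushforward (η : eigenvalueSet d M → ℝ) {ζ : M ≃ₘ⟮𝓡 d, 𝓡 d⟯ M}
    (hζ : IsIsometry d ζ) {f : M → ℂ} (hf : MemLp f 2 (riemannianVolume d M)) :
    B.spectralOperator η (pushforward ζ f)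
      =ᵐ[riemannianVolume d M] pushforward ζ (B.spectralOperator η f) := by
  by_cases h : B.InDomain η f
  · exact IsImage.ae_eq B (memLp_pushforward hζ hf)
      (B.isImage_spectralOperator ((B.inDomain_pushforward_iff hζ hf).2 h))
      ((B.isImage_spectralOperator h).pushforward B hζ hf)
  · rw [spectralOperator, spectralOperator, dif_neg h,
      dif_neg (mt (B.inDomain_pushforward_iff hζ hf).1 h)]
    rfl

end Isometry

end LaplaceEigenbasis

end SpectralGeometry

end

open SpectralGeometry in
theorem theorem3 (d : ℕ) {M : Type*} [TopologicalSpace M] [T2Space M] [CompactSpace M]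
    [ConnectedSpace M] [MeasurableSpace M] [BorelSpace M]
    [ChartedSpace (EuclideanSpace ℝ (Fin d)) M] [IsManifold (𝓡 d) ∞ M]
    [RiemannianBundle (fun x : M ↦ TangentSpace (𝓡 d) x)]
    [IsContMDiffRiemannianBundle (𝓡 d) ∞ (EuclideanSpace ℝ (Fin d))
      (fun x : M ↦ TangentSpace (𝓡 d) x)]
    (B : LaplaceEigenbasis d M) (η : eigenvalueSet d M → ℝ) :
    (∀ f : M → ℂ, MemLp f 2 (riemannianVolume d M) →
      ∀ ζ : M ≃ₘ⟮𝓡 d, 𝓡 d⟯ M, IsIsometry d ζ →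
        MemLp (pushforward ζ f) 2 (riemannianVolume d M) ∧
        (B.InDomain η (pushforward ζ f) ↔ B.InDomain η f) ∧
        B.spectralOperator η (pushforward ζ f)
          =ᵐ[riemannianVolume d M] pushforward ζ (B.spectralOperator η f)) ∧
    ((∃ C : ℝ, ∀ l, |η l| ≤ C) →
      ∀ f : M → ℂ, MemLp f 2 (riemannianVolume d M) → B.InDomain η f) := by
  have : IsContinuousRiemannianBundle (EuclideanSpace ℝ (Fin d))
      (fun x : M ↦ TangentSpace (𝓡 d) x) := isContinuousRiemannianBundle_tangentSpace
  exact ⟨fun f hf ζ hζ ↦ ⟨LaplaceEigenbasis.memLp_pushforward hζ hf,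
    B.inDomain_pushforward_iff hζ hf, B.spectralOperator_pushforward η hζ hf⟩,
    fun ⟨_, hC⟩ f hf ↦ B.inDomain_of_bounded hC hf⟩
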